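/- Let $R$ be a finite valuation ring, that is, a finite commutative ring with identity that is local and principal. Let $\pi$ be a generator of its maximal ideal, let $q$ be the number of elements of the residue field $R/(\pi)$, and let $\ell$ be the smallest positive integer with $\pi^\ell=0$. Assume that $q$ is odd. Let $\mathrm{Pl}(R)$ be the Platonic graph of $R$: its vertex set is $R^{2,u}/\{\pm1\}$, where $R^{2,u}$ is the set of pairs $(a,b)\in R^2$ whose entries generate $R$ as an ideal, and two vertices $[a,b]$ and $[c,d]$ are adjacent exactly when $ad-bc=\pm1$. Then $R$ is a field if and only if $\ell=1$, and $R$ is not a field if and only if $\ell\ge 2$. The set of eigenvalues (without multiplicities) of the adjacency operator of $\mathrm{Pl}(R)$, acting on complex-valued functions on the vertex set, is as follows. i) If $R$ is a field, i.e. $\ell=1$: the set of eigenvalues is $\{q,\,-1,\,q^{1/2},\,-q^{1/2}\}$ when $q\neq 3$, and $\{q,\,-1\}$ when $q=3$. ii) If $R$ is not a field, i.e. $\ell\geq 2$: the set of eigenvalues is $\{q^\ell,\,0\}\cup\{\pm q^{\ell-k/2} : 1\le k\le \ell\}$ when $q\neq 3$, and $\{q^\ell,\,0\}\cup\{\pm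 q^{\ell-k/2} : 2\le k\le \ell\}$ when $q=3$. -/

import Mathlib

/-- The set `R^{2,u}` of unimodular pairs over `R`: the pairs whose entries generate `R` as an
ideal. -/
def UnimodularPair (R : Type*) [CommRing R] : Type _ :=
  {v : R × R // Ideal.span {v.1, v.2} = (⊤ : Ideal R)}

/-- Unimodular pairs up to sign. -/
def UnimodularPair.signSetoid (R : Type*) [CommRing R] : Setoid (UnimodularPair R) where
  r v w := v.1 = w.1 ∨ v.1 = -w.1
  iseqv :=
    { refl := fun _ => Or.inl rfl
      symm := by
        rintro v w (h | h)
        · exact Or.inl h.symm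
        · exact Or.inr (by rw [h, neg_neg])
      trans := by
        rintro u v w (h | h) (h' | h')
        · exact Or.inl (h.trans h')
        · exact Or.inr (h.trans h')
        · exact Or.inr (by rw [h, h'])
        · exact Or.inl (by rw [h, h', neg_neg]) }

/-- The vertex set `R^{2,u} / {±1}` of the Platonic graph. -/
def PlatonicVertex (R : Type*) [CommRing R] : Type _ :=
  Quotient (UnimodularPair.signSetoid R)

instance PlatonicVertex.instFinite (R : Type*) [CommRing R] [Finite R] :
    Finite (PlatonicVertex R) := by
  have : Finite (UnimodularPair R) := Subtype.finite
  exact Quotient.finite _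

/-- The Platonic graph `Pl(R)` over a nontrivial ring `R`: the vertices `[a, b]` and `[c, d]` are
adjacent when `a * d - b * c = ±1`. -/
def platonicGraph (R : Type*) [CommRing R] [Nontrivial R] : SimpleGraph (PlatonicVertex R) where
  Adj := Quotient.lift₂ (s₁ := UnimodularPair.signSetoid R) (s₂ := UnimodularPair.signSetoid R)
    (fun v w : UnimodularPair R =>
      v.1.1 * w.1.2 - v.1.2 * w.1.1 = 1 ∨ v.1.1 * w.1.2 - v.1.2 * w.1.1 = -1)
    (by
      rintro v w v' w' (h | h) (h' | h')
      · simp only [h, h']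
      · simp only [h, h', Prod.fst_neg, Prod.snd_neg]
        apply propext
        constructor
        · rintro (e | e)
          · right; linear_combination -e
          · left; linear_combination -e
        · rintro (e | e)
          · right; linear_combination -e
          · left; linear_combination -e
      · simp only [h, h', Prod.fst_neg, Prod.snd_neg]
        apply propext
        constructor
        · rintro (e | e)
          · right; linear_combination -e
          · left; linear_combination -e
        · rintro (e | e)
          · right; linear_combination -e
          · left; linear_combination -e
      · simp only [h, h', Prod.fst_neg, Prod.snd_neg, neg_mul_neg])
  symm := ⟨by
    intro x y
    induction x using Quotient.inductionOn with | _ v =>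
    induction y using Quotient.inductionOn with | _ w =>
    rintro (e | e)
    · right; linear_combination -e
    · left; linear_combination -e⟩
  loopless := ⟨by
    intro x
    induction x using Quotient.inductionOn with | _ v =>
    have h0 : v.1.1 * v.1.2 - v.1.2 * v.1.1 = 0 := by ring
    rintro (e | e)
    · exact zero_ne_one (h0.symm.trans e)
    · exact neg_ne_zero.mpr one_ne_zero (e.symm.trans h0)⟩

open Classical in
/-- The set of adjacency eigenvalues of a finite graph: the eigenvalues of its adjacency matrix,
acting on complex-valued functions on the vertices. -/
noncomputable def adjEigenvalues {V : Type*} [Finite V] (G : SimpleGraph V) : Set ℂ :=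
  letI : Fintype V := Fintype.ofFinite V
  {μ : ℂ | Module.End.HasEigenvalue (Matrix.toLin' (G.adjMatrix ℂ)) μ}

/-! Since 1 ≠ -1 in R, each neighbour of [v] has exactly one representative w with `symp v w = 1`.
Hence adjacency becomes the operator T = `sympSum` on even functions supported on unimodular pairs.
The solutions w form an affine line w + Rv, so T and T² are explicit sums.

Write N_j for the number of multiples of p^j, which is q^(l-j) for j ≤ l, and filter functions by
level, i.e. by dependence modulo p^j only. Let F have level k+1. If its sum over the units congruent
to 1 modulo p^k vanishes, then T²F = N_(k+1)|R| F (`sympSum_sympSum_of_unitSum_eq_zero`): the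
remaining terms of T²F are unchanged under dilation by those units and cancel. This produces the
values ±q^(l-k/2), with k here shifted by one.

If instead an eigenfunction has nonzero unit sum, replace it by that sum. For k ≥ 1, averaging it
over translates by p^k changes T only by a nonzero scalar (`sympSum_translateSum`), so either the
eigenvalue is 0 or the level drops and induction applies. At the bottom lie functions on the
projective line over the residue field, where T has only the eigenvalues |R| and -N_1
(`eigenvalue_of_unit_invariant`).

Conversely, each value is attained. Explicit differences of indicators give -N_1 and 0. For both
signs of a square root, `exists_eigenfunction_of_sq` uses a similitude of the form: if T were a
scalar on the space with vanishing unit sums, functions there would be invariant under all units.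
That space is nonzero when some unit is 1 modulo p^k but not ±1 modulo p^(k+1); this fails only for
k = 0 and q = 3. -/

/-- The standard symplectic form on `R × R`. -/
def symp {R : Type*} [CommRing R] (v w : R × R) : R := v.1 * w.2 - v.2 * w.1

open Classical in
/-- The operator summing a function over the pairs `w` with `symp v w = 1`. -/
noncomputable def sympSum {R : Type*} [CommRing R] [Fintype R] (F : R × R → ℂ) (v : R × R) : ℂ :=
  ∑ w, if symp v w = 1 then F w else 0

/-- Even functions on `R × R` which vanish outside the unimodular pairs. -/
structure IsEvenUnimodular {R : Type*} [CommRing R] (F : R × R → ℂ) : Prop where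
  even : ∀ v, F (-v) = F v
  supp : ∀ v, F v ≠ 0 → ∃ w, symp v w = 1

/-! ### The symplectic form and the operator `sympSum` -/

section Symp

variable {R : Type*} [CommRing R]

theorem symp_smul_left (t : R) (v w : R × R) : symp (t • v) w = t * symp v w := by
  simp only [symp, Prod.smul_fst, Prod.smul_snd, smul_eq_mul]; ring

theorem symp_smul_right (t : R) (v w : R × R) : symp v (t • w) = t * symp v w := by
  simp only [symp, Prod.smul_fst, Prod.smul_snd, smul_eq_mul]; ring

theorem symp_neg_left (v w : R × R) : symp (-v) w = -symp v w := by
  simp only [symp, Prod.fst_neg, Prod.snd_neg]; ring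

theorem symp_neg_right (v w : R × R) : symp v (-w) = -symp v w := by
  simp only [symp, Prod.fst_neg, Prod.snd_neg]; ring

theorem symp_add_left (u v w : R × R) : symp (u + v) w = symp u w + symp v w := by
  simp only [symp, Prod.fst_add, Prod.snd_add]; ring

theorem symp_add_right (u v w : R × R) : symp u (v + w) = symp u v + symp u w := by
  simp only [symp, Prod.fst_add, Prod.snd_add]; ring

theorem symp_self (v : R × R) : symp v v = 0 := by
  simp only [symp]; ring

theorem symp_swap (v w : R × R) : symp w v = -symp v w := by
  simp only [symp]; ring

theorem span_pair_eq_top_iff (v : R × R) :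
    Ideal.span {v.1, v.2} = (⊤ : Ideal R) ↔ ∃ w, symp v w = 1 := by
  rw [Ideal.eq_top_iff_one, Ideal.mem_span_pair]
  constructor
  · rintro ⟨a, b, h⟩
    exact ⟨(-b, a), by simp only [symp]; linear_combination h⟩
  · rintro ⟨w, h⟩
    exact ⟨w.2, -w.1, by simp only [symp] at h; linear_combination h⟩

/-- The coordinates with respect to a symplectic basis. -/
def sympEquiv {v w : R × R} (h : symp v w = 1) : R × R ≃ R × R where
  toFun c := c.1 • w + c.2 • v
  invFun u := (symp v u, symp u w)
  left_inv c := by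
    ext
    · simp [symp_add_right, symp_smul_right, symp_self, h]
    · simp [symp_add_left, symp_smul_left, symp_self, h]
  right_inv u := by
    simp only [symp] at h
    ext
    · simp only [symp, Prod.fst_add, Prod.smul_fst, smul_eq_mul]
      linear_combination u.1 * h
    · simp only [symp, Prod.snd_add, Prod.smul_snd, smul_eq_mul]
      linear_combination u.2 * h

variable [Fintype R]

theorem sum_eq_sum_basis {v w : R × R} (h : symp v w = 1) (f : R × R → ℂ) :
    ∑ u, f u = ∑ s : R, ∑ z : R, f (s • w + z • v) := by
  rw [← (sympEquiv h).sum_comp f, Fintype.sum_prod_type]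
  rfl

/-- In the basis w, v the condition on a pair fixes its w-coordinate to be 1 and leaves the
v-coordinate free. -/
theorem sympSum_eq {v w : R × R} (h : symp v w = 1) (F : R × R → ℂ) :
    sympSum F v = ∑ x : R, F (w + x • v) := by
  classical
  rw [sympSum, sum_eq_sum_basis h]
  simp only [symp_add_right, symp_smul_right, symp_self, h, mul_zero, add_zero, mul_one]
  rw [Finset.sum_eq_single 1]
  · simp
  · intro s _ hs
    simp [hs]
  · simp

theorem sympSum_eq_zero {v : R × R} (h : ¬ ∃ w, symp v w = 1) (F : R × R → ℂ) :
    sympSum F v = 0 := by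
  classical
  push Not at h
  simp [sympSum, h]

theorem sympSum_sympSum_eq {v w : R × R} (h : symp v w = 1) (F : R × R → ℂ) :
    sympSum (sympSum F) v = ∑ s : R, ∑ x : R, F (-v + s • (w + x • v)) := by
  rw [sympSum_eq h, Finset.sum_comm]
  -- The base point chosen on the line attached to w + xv is -v.
  refine Finset.sum_congr rfl fun x _ => sympSum_eq ?_ F
  simp [symp_neg_right, symp_add_left, symp_smul_left, symp_self, symp_swap v w, h]

theorem sympSum_add (F G : R × R → ℂ) : sympSum (F + G) = sympSum F + sympSum G := by
  classical
  ext v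
  simp only [sympSum, Pi.add_apply, ← Finset.sum_add_distrib]
  refine Finset.sum_congr rfl fun w _ => ?_
  split_ifs <;> simp

theorem sympSum_smul (c : ℂ) (F : R × R → ℂ) : sympSum (c • F) = c • sympSum F := by
  classical
  ext v
  simp only [sympSum, Pi.smul_apply, smul_eq_mul, Finset.mul_sum, mul_ite, mul_zero]

theorem sympSum_sum {ι : Type*} (s : Finset ι) (F : ι → R × R → ℂ) (v : R × R) :
    sympSum (fun u => ∑ i ∈ s, F i u) v = ∑ i ∈ s, sympSum (F i) v := by
  classical
  simp only [sympSum]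
  rw [Finset.sum_comm]
  refine Finset.sum_congr rfl fun w _ => ?_
  split_ifs <;> simp

/-- A similitude with multiplier c sends the pairs of value 1 to pairs of value c, and dilating by
the inverse of c restores 1. So it commutes with the operator only up to a dilation; this
discrepancy later forces both signs to occur. -/
theorem sympSum_comp_of_symp {c : Rˣ} (g : R × R ≃ R × R)
    (hg : ∀ v w, symp (g v) (g w) = c * symp v w) (F : R × R → ℂ) (v : R × R) :
    sympSum (fun u => F (g u)) v = sympSum (fun u => F ((c : R) • u)) (g v) := by
  classical
  simp only [sympSum]
  let e : R × R ≃ R × R := g.trans (MulAction.toPerm (c⁻¹ : Rˣ))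
  have he : ∀ u, e u = ((c⁻¹ : Rˣ) : R) • g u := fun u => rfl
  symm
  rw [← e.sum_comp]
  refine Finset.sum_congr rfl fun w _ => ?_
  rw [he, symp_smul_right, hg, smul_smul]
  simp

theorem sympSum_smul_units (c : Rˣ) (F : R × R → ℂ) (v : R × R) :
    sympSum F ((c : R) • v) = sympSum (fun u => F (((c⁻¹ : Rˣ) : R) • u)) v := by
  classical
  simp only [sympSum]
  rw [← Equiv.sum_comp (MulAction.toPerm (c⁻¹ : Rˣ) : Equiv.Perm (R × R))]
  refine Finset.sum_congr rfl fun w _ => ?_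
  have he : (MulAction.toPerm (c⁻¹ : Rˣ) : Equiv.Perm (R × R)) w = ((c⁻¹ : Rˣ) : R) • w := rfl
  rw [he, symp_smul_right, symp_smul_left]
  simp

theorem IsEvenUnimodular.sympSum {F : R × R → ℂ} (hF : IsEvenUnimodular F) :
    IsEvenUnimodular (sympSum F) where
  even v := by
    have := sympSum_smul_units (-1) F v
    simpa [hF.even] using this
  supp v hv := by
    by_contra h
    exact hv (sympSum_eq_zero h F)

end Symp

/-! ### From graph eigenvalues to even functions on unimodular pairs -/

section Bridge

variable {R : Type*} [CommRing R]

/-- The vertex of the Platonic graph given by a unimodular pair. -/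
def PlatonicVertex.mk (v : R × R) (h : Ideal.span {v.1, v.2} = (⊤ : Ideal R)) :
    PlatonicVertex R :=
  Quotient.mk (UnimodularPair.signSetoid R) ⟨v, h⟩

theorem PlatonicVertex.mk_eq_mk_iff {v w : R × R} (hv : Ideal.span {v.1, v.2} = (⊤ : Ideal R))
    (hw : Ideal.span {w.1, w.2} = (⊤ : Ideal R)) :
    PlatonicVertex.mk v hv = PlatonicVertex.mk w hw ↔ v = w ∨ v = -w :=
  ⟨fun h => Quotient.exact h, fun h => Quotient.sound h⟩

theorem PlatonicVertex.exists_mk (x : PlatonicVertex R) : ∃ v h, PlatonicVertex.mk v h = x := by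
  obtain ⟨v, rfl⟩ := Quotient.exists_rep x
  exact ⟨v.1, v.2, rfl⟩

theorem platonicGraph_adj_mk_iff [Nontrivial R] {v w : R × R}
    (hv : Ideal.span {v.1, v.2} = (⊤ : Ideal R)) (hw : Ideal.span {w.1, w.2} = (⊤ : Ideal R)) :
    (platonicGraph R).Adj (PlatonicVertex.mk v hv) (PlatonicVertex.mk w hw) ↔
      symp v w = 1 ∨ symp v w = -1 :=
  Iff.rfl

/-- The function on pairs induced by a function on the vertices of the Platonic graph. -/
noncomputable def vertexLift (f : PlatonicVertex R → ℂ) (v : R × R) : ℂ :=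
  open Classical in
  if h : Ideal.span {v.1, v.2} = (⊤ : Ideal R) then f (PlatonicVertex.mk v h) else 0

theorem vertexLift_of_span (f : PlatonicVertex R → ℂ) {v : R × R}
    (h : Ideal.span {v.1, v.2} = (⊤ : Ideal R)) :
    vertexLift f v = f (PlatonicVertex.mk v h) :=
  dif_pos h

theorem vertexLift_of_not_span (f : PlatonicVertex R → ℂ) {v : R × R}
    (h : ¬ Ideal.span {v.1, v.2} = (⊤ : Ideal R)) : vertexLift f v = 0 :=
  dif_neg h

theorem span_neg_pair (v : R × R) :
    (Ideal.span {(-v).1, (-v).2} : Ideal R) = Ideal.span {v.1, v.2} := by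
  ext x
  simp only [Ideal.mem_span_pair, Prod.fst_neg, Prod.snd_neg]
  constructor
  · rintro ⟨a, b, h⟩
    exact ⟨-a, -b, by rw [← h]; ring⟩
  · rintro ⟨a, b, h⟩
    exact ⟨-a, -b, by rw [← h]; ring⟩

theorem isEvenUnimodular_vertexLift (f : PlatonicVertex R → ℂ) :
    IsEvenUnimodular (vertexLift f) where
  even v := by
    by_cases h : Ideal.span {v.1, v.2} = (⊤ : Ideal R)
    · rw [vertexLift_of_span f h, vertexLift_of_span f ((span_neg_pair v).trans h),
        (PlatonicVertex.mk_eq_mk_iff _ h).2 (Or.inr rfl)]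
    · rw [vertexLift, vertexLift, dif_neg h, dif_neg (by rwa [span_neg_pair])]
  supp v hv := by
    rw [← span_pair_eq_top_iff]
    by_contra h
    exact hv (dif_neg h)

theorem exists_vertexLift_eq {F : R × R → ℂ} (hF : IsEvenUnimodular F) :
    ∃ f : PlatonicVertex R → ℂ, vertexLift f = F := by
  refine ⟨Quotient.lift (s := UnimodularPair.signSetoid R) (fun v : UnimodularPair R => F v.1)
    ?_, ?_⟩
  · rintro v w (e | e)
    · simp only [e]
    · simp only [e, hF.even]
  · ext v
    by_cases hv : Ideal.span {v.1, v.2} = (⊤ : Ideal R)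
    · exact vertexLift_of_span _ hv
    · refine (vertexLift_of_not_span _ hv).trans ?_
      by_contra h0
      exact hv ((span_pair_eq_top_iff v).2 (hF.supp v (Ne.symm h0)))

theorem vertexLift_injective : Function.Injective (vertexLift (R := R)) := by
  intro f g h
  ext x
  obtain ⟨v, hv, rfl⟩ := x.exists_mk
  rw [← vertexLift_of_span f hv, ← vertexLift_of_span g hv, h]

theorem vertexLift_smul (c : ℂ) (f : PlatonicVertex R → ℂ) :
    vertexLift (c • f) = c • vertexLift f := by
  ext v
  simp only [vertexLift, Pi.smul_apply]
  split_ifs <;> simp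

variable [Fintype R] [Nontrivial R]

-- Of the two representatives ±w of a neighbour exactly one has form value 1; `h2` excludes counting
-- a neighbour twice.
open Classical in
theorem vertexLift_adjMatrix_mulVec [Fintype (PlatonicVertex R)] (h2 : (1 : R) ≠ -1)
    (f : PlatonicVertex R → ℂ) :
    vertexLift (((platonicGraph R).adjMatrix ℂ).mulVec f) = sympSum (vertexLift f) := by
  ext v
  by_cases hv : Ideal.span {v.1, v.2} = (⊤ : Ideal R)
  swap
  · rw [sympSum_eq_zero (by rwa [← span_pair_eq_top_iff]), vertexLift, dif_neg hv]
  rw [vertexLift_of_span _ hv, SimpleGraph.adjMatrix_mulVec_apply, sympSum,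
    ← Finset.sum_filter]
  symm
  have huni : ∀ w : R × R, symp v w = 1 → Ideal.span {w.1, w.2} = (⊤ : Ideal R) := by
    intro w hw
    rw [span_pair_eq_top_iff]
    exact ⟨-v, by rw [symp_neg_right, symp_swap, hw, neg_neg]⟩
  refine Finset.sum_bij
    (fun w hw => PlatonicVertex.mk w (huni w (Finset.mem_filter.1 hw).2)) ?_ ?_ ?_ ?_
  · intro w hw
    rw [SimpleGraph.mem_neighborFinset, platonicGraph_adj_mk_iff]
    exact Or.inl (Finset.mem_filter.1 hw).2
  · intro w hw w' hw' h
    rcases (PlatonicVertex.mk_eq_mk_iff _ _).1 h with h | h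
    · exact h
    · exfalso
      have h1 := (Finset.mem_filter.1 hw).2
      have h1' := (Finset.mem_filter.1 hw').2
      rw [h, symp_neg_right, h1'] at h1
      exact h2 h1.symm
  · intro y hy
    obtain ⟨w, hw, rfl⟩ := y.exists_mk
    rw [SimpleGraph.mem_neighborFinset, platonicGraph_adj_mk_iff] at hy
    rcases hy with e | e
    · exact ⟨w, Finset.mem_filter.2 ⟨Finset.mem_univ _, e⟩, rfl⟩
    · have e' : symp v (-w) = 1 := by rw [symp_neg_right, e, neg_neg]
      exact ⟨-w, Finset.mem_filter.2 ⟨Finset.mem_univ _, e'⟩,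
        (PlatonicVertex.mk_eq_mk_iff _ _).2 (Or.inr rfl)⟩
  · intro w hw
    exact vertexLift_of_span f _

theorem mem_adjEigenvalues_platonicGraph_iff (h2 : (1 : R) ≠ -1) (μ : ℂ) :
    μ ∈ adjEigenvalues (platonicGraph R) ↔
      ∃ F : R × R → ℂ, IsEvenUnimodular F ∧ F ≠ 0 ∧ sympSum F = μ • F := by
  classical
  let : Fintype (PlatonicVertex R) := Fintype.ofFinite _
  have key : μ ∈ adjEigenvalues (platonicGraph R) ↔
      ∃ f : PlatonicVertex R → ℂ, f ≠ 0 ∧ ((platonicGraph R).adjMatrix ℂ).mulVec f = μ • f := by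
    constructor
    · intro h
      obtain ⟨f, hf⟩ := Module.End.HasEigenvalue.exists_hasEigenvector h
      exact ⟨f, hf.2, by simpa using hf.apply_eq_smul⟩
    · rintro ⟨f, hf, h⟩
      exact Module.End.hasEigenvalue_of_hasEigenvector
        ⟨Module.End.mem_eigenspace_iff.2 (by simpa using h), hf⟩
  have h0 : vertexLift (0 : PlatonicVertex R → ℂ) = 0 := by
    ext v
    simp only [vertexLift, Pi.zero_apply]
    split_ifs <;> rfl
  rw [key]
  constructor
  · rintro ⟨f, hf, h⟩
    refine ⟨vertexLift f, isEvenUnimodular_vertexLift f, fun h' => ?_, ?_⟩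
    · exact hf (vertexLift_injective (h'.trans h0.symm))
    · rw [← vertexLift_adjMatrix_mulVec h2, h, vertexLift_smul]
  · rintro ⟨F, hE, hF, h⟩
    obtain ⟨f, rfl⟩ := exists_vertexLift_eq hE
    refine ⟨f, ?_, ?_⟩
    · rintro rfl
      exact hF h0
    · apply vertexLift_injective
      rw [vertexLift_adjMatrix_mulVec h2, h, vertexLift_smul]

end Bridge

/-! ### Levels and averaging operators -/

/-- Functions on pairs depending only on the residue classes modulo `p ^ j`. -/
def IsLevel {R : Type*} [CommRing R] (p : R) (j : ℕ) (F : R × R → ℂ) : Prop :=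
  ∀ v w : R × R, p ^ j ∣ w.1 - v.1 → p ^ j ∣ w.2 - v.2 → F w = F v

open Classical in
/-- The sum of a function over the orbits of the units congruent to `1` modulo `p ^ k`. -/
noncomputable def unitSum {R : Type*} [CommRing R] [Fintype R] (p : R) (k : ℕ)
    (F : R × R → ℂ) (v : R × R) : ℂ :=
  ∑ t : Rˣ, if p ^ k ∣ (t : R) - 1 then F ((t : R) • v) else 0

/-- The sum of a function over the translates by multiples of `p ^ k`. -/
def translateSum {R : Type*} [CommRing R] [Fintype R] (p : R) (k : ℕ)
    (F : R × R → ℂ) (v : R × R) : ℂ :=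
  ∑ a : R × R, F (v + p ^ k • a)

open Classical in
/-- The number of multiples of `a`. -/
noncomputable def multipleCount {R : Type*} [CommRing R] [Fintype R] (a : R) : ℕ :=
  (Finset.univ.filter fun s : R => a ∣ s).card

/-! ### Divisibility in a local ring with principal maximal ideal -/

section Local

variable {R : Type*} [CommRing R] {p : R}

theorem exists_symp_eq_one_of_isUnit_fst {v : R × R} (h : IsUnit v.1) :
    ∃ w, symp v w = 1 := by
  obtain ⟨u, hu⟩ := h
  exact ⟨(0, ((u⁻¹ : Rˣ) : R)), by simp [symp, ← hu]⟩

theorem exists_symp_eq_one_of_isUnit_snd {v : R × R} (h : IsUnit v.2) :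
    ∃ w, symp v w = 1 := by
  obtain ⟨u, hu⟩ := h
  exact ⟨(-((u⁻¹ : Rˣ) : R), 0), by simp [symp, ← hu]⟩

variable [IsLocalRing R]

theorem not_isUnit_iff_dvd (hp : IsLocalRing.maximalIdeal R = Ideal.span {p}) (x : R) :
    ¬ IsUnit x ↔ p ∣ x := by
  rw [← mem_nonunits_iff, ← IsLocalRing.mem_maximalIdeal, hp, Ideal.mem_span_singleton]

/-- Divisibility form of "every element is a unit times a power of p, or is divisible by all
powers". -/
theorem pow_succ_dvd_or_dvd_pow (hp : IsLocalRing.maximalIdeal R = Ideal.span {p}) (k : ℕ)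
    (s : R) : p ^ (k + 1) ∣ s ∨ s ∣ p ^ k := by
  induction k with
  | zero =>
    by_cases h : IsUnit s
    · exact Or.inr h.dvd
    · rw [not_isUnit_iff_dvd hp] at h
      exact Or.inl (by simpa using h)
  | succ k ih =>
    rcases ih with ⟨r, rfl⟩ | h
    · by_cases h : IsUnit r
      · exact Or.inr (h.mul_right_dvd.2 dvd_rfl)
      · rw [not_isUnit_iff_dvd hp] at h
        exact Or.inl (by rw [pow_succ p (k + 1)]; exact mul_dvd_mul_left _ h)
    · exact Or.inr (h.trans (pow_dvd_pow p k.le_succ))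

theorem isUnit_one_add_of_dvd (hp : IsLocalRing.maximalIdeal R = Ideal.span {p}) {x : R}
    (h : p ∣ x) : IsUnit (1 + x) := by
  by_contra h1
  rw [not_isUnit_iff_dvd hp] at h1
  have h2 : p ∣ 1 := (dvd_add_left h).1 h1
  rw [← not_isUnit_iff_dvd hp] at h2
  exact h2 isUnit_one

end Local

/-! ### Interaction of the operator with levels and averages -/

section Level

variable {R : Type*} [CommRing R] {p : R} {k : ℕ} {F : R × R → ℂ}

theorem IsLevel.add_smul (h : IsLevel p k F) (v a : R × R) : F (v + p ^ k • a) = F v := by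
  apply h
  · simp
  · simp

theorem isLevel_of_add_smul (h : ∀ v a : R × R, F (v + p ^ k • a) = F v) : IsLevel p k F := by
  rintro v w ⟨a, ha⟩ ⟨b, hb⟩
  rw [← h v (a, b)]
  congr 1
  ext
  · simp [← ha]
  · simp [← hb]

theorem IsLevel.const_smul (h : IsLevel p k F) (c : ℂ) : IsLevel p k (c • F) := by
  intro v w h1 h2
  simp only [Pi.smul_apply, h v w h1 h2]

theorem IsEvenUnimodular.const_smul (h : IsEvenUnimodular F) (c : ℂ) :
    IsEvenUnimodular (c • F) where
  even v := by simp only [Pi.smul_apply, h.even]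
  supp v hv := h.supp v fun h0 => hv (by simp [h0])

theorem IsEvenUnimodular.add {G : R × R → ℂ} (hF : IsEvenUnimodular F)
    (hG : IsEvenUnimodular G) : IsEvenUnimodular (F + G) where
  even v := by simp only [Pi.add_apply, hF.even, hG.even]
  supp v hv := by
    by_contra h
    apply hv
    rw [Pi.add_apply, not_imp_comm.1 (hF.supp v) h, not_imp_comm.1 (hG.supp v) h, add_zero]

theorem IsEvenUnimodular.sub {G : R × R → ℂ} (hF : IsEvenUnimodular F)
    (hG : IsEvenUnimodular G) : IsEvenUnimodular (F - G) := by
  have := hF.add (hG.const_smul (-1))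
  rwa [neg_one_smul, ← sub_eq_add_neg] at this

theorem IsLevel.sub {G : R × R → ℂ} (hF : IsLevel p k F) (hG : IsLevel p k G) :
    IsLevel p k (F - G) := by
  intro v w h1 h2
  simp only [Pi.sub_apply, hF v w h1 h2, hG v w h1 h2]

theorem isEvenUnimodular_indicator (P : R × R → Prop) [DecidablePred P]
    (h1 : ∀ v, P (-v) ↔ P v) (h2 : ∀ v, P v → ∃ w, symp v w = 1) :
    IsEvenUnimodular (fun v => if P v then (1 : ℂ) else 0) where
  even v := by simp only [h1]
  supp v hv := h2 v (by
    by_contra h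
    exact hv (if_neg h))

variable [Fintype R]

theorem unitSum_smul {c : Rˣ} (hc : p ^ k ∣ (c : R) - 1) (v : R × R) :
    unitSum p k F ((c : R) • v) = unitSum p k F v := by
  classical
  simp only [unitSum]
  rw [← Equiv.sum_comp (Equiv.mulLeft c) (fun t : Rˣ =>
    if p ^ k ∣ (t : R) - 1 then F ((t : R) • v) else 0)]
  refine Finset.sum_congr rfl fun t _ => ?_
  have h : p ^ k ∣ ((c * t : Rˣ) : R) - 1 ↔ p ^ k ∣ (t : R) - 1 := by
    have e : ((c * t : Rˣ) : R) - 1 = ((c : R) - 1) * t + ((t : R) - 1) := by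
      push_cast; ring
    rw [e, dvd_add_right (hc.mul_right _)]
  simp only [Equiv.coe_mulLeft, h]
  simp only [smul_smul, Units.val_mul, mul_comm (c : R)]

theorem unitSum_eq_mul_of_forall {v : R × R}
    (h : ∀ t : Rˣ, p ^ k ∣ (t : R) - 1 → F ((t : R) • v) = F v) :
    ∃ N : ℂ, N ≠ 0 ∧ unitSum p k F v = N * F v := by
  classical
  refine ⟨((Finset.univ.filter fun t : Rˣ => p ^ k ∣ (t : R) - 1).card : ℂ), ?_, ?_⟩
  · rw [Nat.cast_ne_zero, Finset.card_ne_zero]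
    exact ⟨1, by simp⟩
  · rw [unitSum, ← Finset.sum_filter, ← nsmul_eq_mul, ← Finset.sum_const]
    exact Finset.sum_congr rfl fun t ht => h t (Finset.mem_filter.1 ht).2

theorem eq_zero_of_unitSum_eq_zero (h0 : unitSum p k F = 0)
    (h : ∀ v, ∀ t : Rˣ, p ^ k ∣ (t : R) - 1 → F ((t : R) • v) = F v) : F = 0 := by
  ext v
  obtain ⟨N, hN, e⟩ := unitSum_eq_mul_of_forall (h v)
  rw [h0, Pi.zero_apply, eq_comm, mul_eq_zero] at e
  exact e.resolve_left hN

theorem IsLevel.unitSum {j : ℕ} (h : IsLevel p j F) : IsLevel p j (unitSum p k F) := by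
  classical
  intro v w h1 h2
  refine Finset.sum_congr rfl fun t _ => ?_
  rw [h ((t : R) • v) ((t : R) • w)]
  · simpa only [Prod.smul_fst, smul_eq_mul, mul_sub] using h1.mul_left (t : R)
  · simpa only [Prod.smul_snd, smul_eq_mul, mul_sub] using h2.mul_left (t : R)

theorem IsEvenUnimodular.unitSum (h : IsEvenUnimodular F) :
    IsEvenUnimodular (unitSum p k F) where
  even v := by simp only [_root_.unitSum, smul_neg, h.even]
  supp v hv := by
    classical
    obtain ⟨t, -, ht⟩ := Finset.exists_ne_zero_of_sum_ne_zero hv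
    have ht' : F ((t : R) • v) ≠ 0 := fun h0 => ht (by simp [h0])
    obtain ⟨w, hw⟩ := h.supp _ ht'
    exact ⟨(t : R) • w, by rw [symp_smul_right, ← hw, symp_smul_left]⟩

/-- The operator turns dilation by t into dilation by the inverse of t, and the units congruent to 1
form a group, so the sum is the same. -/
theorem sympSum_unitSum (F : R × R → ℂ) :
    sympSum (unitSum p k F) = unitSum p k (sympSum F) := by
  classical
  ext v
  have h1 : sympSum (unitSum p k F) v = ∑ t : Rˣ, if p ^ k ∣ (t : R) - 1 then
      sympSum (fun u => F ((t : R) • u)) v else 0 := by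
    have h2 : unitSum p k F = fun u => ∑ t ∈ Finset.univ.filter (fun t : Rˣ => p ^ k ∣ (t : R) - 1), F ((t : R) • u) := by
      ext u
      rw [unitSum, Finset.sum_filter]
    rw [h2, ← Finset.sum_filter]
    exact sympSum_sum _ (fun (t : Rˣ) u => F ((t : R) • u)) v
  rw [h1, unitSum, ← Equiv.sum_comp (Equiv.inv Rˣ)]
  refine Finset.sum_congr rfl fun t _ => ?_
  have h : p ^ k ∣ ((t⁻¹ : Rˣ) : R) - 1 ↔ p ^ k ∣ (t : R) - 1 := by
    have e : (t : R) - 1 = -((((t⁻¹ : Rˣ) : R) - 1) * t) := by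
      rw [sub_mul, Units.inv_mul]; ring
    rw [e, dvd_neg, t.isUnit.dvd_mul_right]
  simp only [Equiv.inv_apply, h, sympSum_smul_units]

theorem IsLevel.translateSum (p : R) (k : ℕ) (F : R × R → ℂ) :
    IsLevel p k (translateSum p k F) := by
  apply isLevel_of_add_smul
  intro v b
  simp only [_root_.translateSum]
  rw [← Equiv.sum_comp (Equiv.addLeft b) (fun a => F (v + p ^ k • a))]
  refine Finset.sum_congr rfl fun a _ => ?_
  rw [Equiv.coe_addLeft, smul_add, add_assoc]

theorem multipleCount_eq_sum (a : R) [DecidablePred fun s : R => a ∣ s] (c : ℂ) :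
    ∑ _s : R with a ∣ _s, c = multipleCount a * c := by
  rw [Finset.sum_const, nsmul_eq_mul, multipleCount]
  congr!

variable [IsLocalRing R]

/-- Moving v by a multiple of p^(k+1) changes the form value at w by a unit u congruent to 1.
Rescaling w by the inverse of u moves the whole affine line only by multiples of p^(k+1). The
exponent is positive so that u is a unit. -/
theorem IsLevel.sympSum (hp : IsLocalRing.maximalIdeal R = Ideal.span {p})
    (h : IsLevel p (k + 1) F) : IsLevel p (k + 1) (sympSum F) := by
  have hpk : p ∣ p ^ (k + 1) := dvd_pow_self p k.succ_ne_zero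
  have key : ∀ v a w : R × R, symp v w = 1 →
      _root_.sympSum F (v + p ^ (k + 1) • a) = _root_.sympSum F v := by
    intro v a w hw
    obtain ⟨u, hu⟩ := isUnit_one_add_of_dvd hp (hpk.mul_right (symp a w))
    have hw' : symp (v + p ^ (k + 1) • a) (((u⁻¹ : Rˣ) : R) • w) = 1 := by
      rw [symp_smul_right, symp_add_left, symp_smul_left, hw, ← hu, Units.inv_mul]
    rw [sympSum_eq hw', sympSum_eq hw]
    refine Finset.sum_congr rfl fun x _ => ?_
    have hu1 : ((u⁻¹ : Rˣ) : R) = 1 + p ^ (k + 1) * -(symp a w * ((u⁻¹ : Rˣ) : R)) := by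
      have := u.inv_mul
      rw [hu] at this
      linear_combination this
    rw [← h.add_smul (w + x • v) ((-(symp a w * ((u⁻¹ : Rˣ) : R))) • w + x • a)]
    congr 1
    generalize -(symp a w * ((u⁻¹ : Rˣ) : R)) = y at hu1 ⊢
    rw [hu1]
    module
  apply isLevel_of_add_smul
  intro v a
  by_cases hv : ∃ w, symp v w = 1
  · obtain ⟨w, hw⟩ := hv
    exact key v a w hw
  by_cases hv' : ∃ w, symp (v + p ^ (k + 1) • a) w = 1
  · obtain ⟨w, hw⟩ := hv'
    have := key _ (-a) w hw
    rw [smul_neg, add_neg_cancel_right] at this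
    exact this.symm
  · rw [sympSum_eq_zero hv, sympSum_eq_zero hv']

/-- If p^(k+1) does not divide s, then ts divides p^k and so t - 1 = tsy for some y. Then t(-v + s(w
+ xv)) = -v + ts(w + (x - y)v), and reindexing x and s absorbs the dilation. -/
theorem sum_smul_smul_eq (hp : IsLocalRing.maximalIdeal R = Ideal.span {p})
    [DecidablePred fun s : R => p ^ (k + 1) ∣ s] {t : Rˣ} (ht : p ^ k ∣ (t : R) - 1)
    (v w : R × R) (F : R × R → ℂ) :
    ∑ s : R with ¬ p ^ (k + 1) ∣ s, ∑ x : R, F ((t : R) • (-v + s • (w + x • v))) =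
      ∑ s : R with ¬ p ^ (k + 1) ∣ s, ∑ x : R, F (-v + s • (w + x • v)) := by
  have h1 : ∀ s ∈ Finset.univ.filter (fun s : R => ¬ p ^ (k + 1) ∣ s),
      ∑ x : R, F ((t : R) • (-v + s • (w + x • v))) =
        ∑ x : R, F (-v + ((t : R) * s) • (w + x • v)) := by
    intro s hs
    have hs' := (pow_succ_dvd_or_dvd_pow hp k s).resolve_left (Finset.mem_filter.1 hs).2
    have h2 : (t : R) * s ∣ (t : R) - 1 := (t.isUnit.mul_left_dvd.2 hs').trans ht
    obtain ⟨y, hy⟩ := h2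
    rw [← Equiv.sum_comp (Equiv.subRight y) (fun x => F (-v + ((t : R) * s) • (w + x • v)))]
    refine Finset.sum_congr rfl fun x _ => ?_
    congr 1
    have ht' : (t : R) = 1 + t * s * y := by rw [← hy]; ring
    rw [smul_add, smul_neg]
    nth_rewrite 1 [ht']
    simp only [Equiv.subRight_apply]
    module
  rw [Finset.sum_congr rfl h1]
  refine Finset.sum_equiv t.mulLeft (fun s => ?_) (fun s _ => rfl)
  simp [t.isUnit.dvd_mul_left]

theorem sympSum_sympSum_of_unitSum_eq_zero (hp : IsLocalRing.maximalIdeal R = Ideal.span {p})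
    (hF : IsEvenUnimodular F) (hl : IsLevel p (k + 1) F) (h0 : unitSum p k F = 0) :
    sympSum (sympSum F) =
      ((multipleCount (p ^ (k + 1)) : ℂ) * Fintype.card R) • F := by
  classical
  ext v
  by_cases hv : ∃ w, symp v w = 1
  swap
  · rw [sympSum_eq_zero hv, Pi.smul_apply, not_imp_comm.1 (hF.supp v) hv, smul_zero]
  obtain ⟨w, hw⟩ := hv
  rw [sympSum_sympSum_eq hw,
    ← Finset.sum_filter_add_sum_filter_not Finset.univ (fun s : R => p ^ (k + 1) ∣ s)]
  have hA : ∑ s : R with p ^ (k + 1) ∣ s, ∑ x : R, F (-v + s • (w + x • v)) =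
      (multipleCount (p ^ (k + 1)) : ℂ) * (Fintype.card R * F v) := by
    rw [← multipleCount_eq_sum]
    refine Finset.sum_congr rfl fun s hs => ?_
    obtain ⟨r, rfl⟩ := (Finset.mem_filter.1 hs).2
    simp only [mul_smul, hl.add_smul, hF.even]
    simp
  have hB : ∑ s : R with ¬ p ^ (k + 1) ∣ s, ∑ x : R, F (-v + s • (w + x • v)) = 0 := by
    -- The constant function with value the sum in question: its unit sum is that value times the
    -- number N of units involved, and also equals a sum of values of `unitSum p k F`, all zero.
    let Φ : R × R → ℂ := fun _ =>
      ∑ s : R with ¬ p ^ (k + 1) ∣ s, ∑ x : R, F (-v + s • (w + x • v))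
    obtain ⟨N, hN, e⟩ := unitSum_eq_mul_of_forall (p := p) (k := k) (F := Φ) (v := 0)
      (fun _ _ => rfl)
    have e' : unitSum p k Φ 0 =
        ∑ s : R with ¬ p ^ (k + 1) ∣ s, ∑ x : R, unitSum p k F (-v + s • (w + x • v)) := by
      have hc : ∀ s : R, ∑ x : R, ∑ t ∈ Finset.univ.filter (fun t : Rˣ => p ^ k ∣ (t : R) - 1),
          F ((t : R) • (-v + s • (w + x • v))) = ∑ t ∈ Finset.univ.filter (fun t : Rˣ => p ^ k ∣ (t : R) - 1),
            ∑ x : R, F ((t : R) • (-v + s • (w + x • v))) := fun s => Finset.sum_comm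
      symm
      simp only [unitSum, ← Finset.sum_filter, hc]
      rw [Finset.sum_comm]
      refine Finset.sum_congr rfl fun t ht => ?_
      exact sum_smul_smul_eq hp (Finset.mem_filter.1 ht).2 v w F
    rw [e', h0] at e
    simp only [Pi.zero_apply, Finset.sum_const_zero] at e
    exact (mul_eq_zero.1 e.symm).resolve_left hN
  rw [hA, hB, add_zero, Pi.smul_apply, smul_eq_mul, mul_assoc]

/-- Modulo p^(k+2), u + p^(k+1)(su + zv) equals (1 + p^(k+1)s)(u + p^(k+1)zv). Unit invariance
removes the first factor, and the remaining shift along v disappears in the sum over the affine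
line. Each of the free parameters s and z contributes a factor |R|. -/
theorem sympSum_translateSum (hp : IsLocalRing.maximalIdeal R = Ideal.span {p})
    (hl : IsLevel p (k + 2) F)
    (hF : ∀ v, ∀ t : Rˣ, p ^ (k + 1) ∣ (t : R) - 1 → F ((t : R) • v) = F v) :
    sympSum (translateSum p (k + 1) F) = ((Fintype.card R : ℂ) ^ 2) • sympSum F := by
  ext v
  by_cases hv : ∃ w, symp v w = 1
  swap
  · rw [Pi.smul_apply, sympSum_eq_zero hv, sympSum_eq_zero hv, smul_zero]
  obtain ⟨w, hw⟩ := hv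
  have h1 : ∀ u, symp v u = 1 → translateSum p (k + 1) F u =
      Fintype.card R * ∑ z : R, F (u + (p ^ (k + 1) * z) • v) := by
    intro u hu
    have h2 : ∀ s z : R, F (u + p ^ (k + 1) • (s • u + z • v)) =
        F (u + (p ^ (k + 1) * z) • v) := by
      intro s z
      obtain ⟨t, ht⟩ := isUnit_one_add_of_dvd hp
        ((dvd_pow_self p k.succ_ne_zero).mul_right s : p ∣ p ^ (k + 1) * s)
      rw [← hF (u + (p ^ (k + 1) * z) • v) t (by simp [ht]), ht,
        ← hl.add_smul (u + p ^ (k + 1) • (s • u + z • v)) ((p ^ k * s * z) • v)]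
      congr 1
      rw [pow_succ p k, show p ^ (k + 2) = p ^ k * p * p by ring]
      module
    rw [translateSum, sum_eq_sum_basis hu]
    simp only [h2]
    simp
  rw [sympSum_eq hw, Pi.smul_apply, sympSum_eq hw]
  have h3 : ∀ x : R, translateSum p (k + 1) F (w + x • v) =
      Fintype.card R * ∑ z : R, F (w + (x + p ^ (k + 1) * z) • v) := by
    intro x
    rw [h1 _ (by rw [symp_add_right, symp_smul_right, symp_self, hw, mul_zero, add_zero])]
    simp only [add_smul, add_assoc]
  simp only [h3]
  rw [← Finset.mul_sum, Finset.sum_comm]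
  have h4 : ∀ z : R, ∑ x : R, F (w + (x + p ^ (k + 1) * z) • v) = ∑ x : R, F (w + x • v) :=
    fun z => Equiv.sum_comp (Equiv.addRight (p ^ (k + 1) * z)) (fun x => F (w + x • v))
  simp only [h4, Finset.sum_const, smul_eq_mul, nsmul_eq_mul, Finset.card_univ]
  ring

/-- Split sw + zv by whether s is a unit. A unit s can be scaled away, leaving the affine line; a
nonunit s can be dropped by level 1, leaving multiples of v, of which only unit multiples lie in the
support. -/
theorem sum_eq_of_unit_invariant (hp : IsLocalRing.maximalIdeal R = Ideal.span {p})
    (hE : IsEvenUnimodular F) (hl : IsLevel p 1 F)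
    (hF : ∀ v, ∀ t : Rˣ, F ((t : R) • v) = F v) {v w : R × R} (hw : symp v w = 1) :
    ∑ u, F u = Nat.card Rˣ * (sympSum F v + multipleCount p * F v) := by
  classical
  have hcard : (Finset.univ.filter fun s : R => ¬ p ∣ s).card = Nat.card Rˣ := by
    rw [Nat.card_eq_fintype_card, ← Finset.card_univ]
    symm
    refine Finset.card_bij (fun t _ => (t : R)) (fun t _ => ?_) (fun t _ t' _ h => Units.ext h)
      (fun s hs => ?_)
    · rw [Finset.mem_filter, ← not_isUnit_iff_dvd hp, not_not]
      exact ⟨Finset.mem_univ _, t.isUnit⟩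
    · rw [Finset.mem_filter, ← not_isUnit_iff_dvd hp, not_not] at hs
      obtain ⟨t, ht⟩ := hs.2
      exact ⟨t, Finset.mem_univ _, ht⟩
  have hz : ∑ z : R, F (z • v) = Nat.card Rˣ * F v := by
    rw [← Finset.sum_filter_add_sum_filter_not Finset.univ (fun s : R => p ∣ s),
      Finset.sum_eq_zero, zero_add, ← hcard, ← nsmul_eq_mul, ← Finset.sum_const]
    · refine Finset.sum_congr rfl fun s hs => ?_
      rw [Finset.mem_filter, ← not_isUnit_iff_dvd hp, not_not] at hs
      obtain ⟨t, rfl⟩ := hs.2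
      exact hF v t
    · intro z hz
      rw [Finset.mem_filter, ← not_isUnit_iff_dvd hp] at hz
      by_contra h0
      obtain ⟨u, hu⟩ := hE.supp _ h0
      rw [symp_smul_left] at hu
      exact hz.2 (IsUnit.of_mul_eq_one _ hu)
  rw [sum_eq_sum_basis hw,
    ← Finset.sum_filter_add_sum_filter_not Finset.univ (fun s : R => p ∣ s)]
  have hA : ∑ s : R with p ∣ s, ∑ z : R, F (s • w + z • v) =
      multipleCount p * (Nat.card Rˣ * F v) := by
    rw [← hz, ← multipleCount_eq_sum]
    refine Finset.sum_congr rfl fun s hs => Finset.sum_congr rfl fun z _ => ?_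
    obtain ⟨r, rfl⟩ := (Finset.mem_filter.1 hs).2
    rw [← hl.add_smul (z • v) (r • w), pow_one, smul_smul, add_comm]
  have hB : ∑ s : R with ¬ p ∣ s, ∑ z : R, F (s • w + z • v) =
      Nat.card Rˣ * sympSum F v := by
    rw [← hcard, ← nsmul_eq_mul, ← Finset.sum_const]
    refine Finset.sum_congr rfl fun s hs => ?_
    rw [Finset.mem_filter, ← not_isUnit_iff_dvd hp, not_not] at hs
    obtain ⟨t, rfl⟩ := hs.2
    rw [sympSum_eq hw, ← Equiv.sum_comp t.mulLeft]
    refine Finset.sum_congr rfl fun z _ => ?_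
    rw [← hF (w + z • v) t, smul_add, smul_smul]
    rfl
  rw [hA, hB]
  ring

end Level

/-! ### Possible eigenvalues and explicit eigenfunctions -/

section Spectrum

variable {R : Type*} [CommRing R] [Fintype R] {p : R} {F : R × R → ℂ} {μ : ℂ}

theorem sympSum_sympSum_eq_sq_smul (h : sympSum F = μ • F) :
    sympSum (sympSum F) = μ ^ 2 • F := by
  rw [h, sympSum_smul, h, smul_smul, sq]

theorem unitSum_comp_smul {k : ℕ} {c : Rˣ} (hc : p ^ k ∣ (c : R) - 1) (F : R × R → ℂ) :
    unitSum p k (fun v => F ((c : R) • v)) = unitSum p k F := by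
  ext v
  rw [← unitSum_smul (F := F) hc v]
  simp only [unitSum, smul_comm (c : R)]

theorem exists_eigenfunction_card :
    ∃ G : R × R → ℂ, IsEvenUnimodular G ∧ G ≠ 0 ∧ sympSum G = (Fintype.card R : ℂ) • G := by
  classical
  have hE : IsEvenUnimodular fun v : R × R => if ∃ w, symp v w = 1 then (1 : ℂ) else 0 := by
    refine isEvenUnimodular_indicator (fun v => ∃ w, symp v w = 1) (fun v => ?_) fun v h => h
    constructor
    · rintro ⟨w, hw⟩
      exact ⟨-w, by rwa [symp_neg_right, ← symp_neg_left]⟩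
    · rintro ⟨w, hw⟩
      exact ⟨-w, by rw [symp_neg_right, symp_neg_left, neg_neg, hw]⟩
  refine ⟨_, hE, Function.ne_iff.2 ⟨(1, 0), ?_⟩, ?_⟩
  · have : ∃ w : R × R, symp (1, 0) w = 1 := ⟨(0, 1), by simp [symp]⟩
    simp only [this, if_true]
    exact one_ne_zero
  · ext v
    by_cases hv : ∃ w, symp v w = 1
    · obtain ⟨w, hw⟩ := hv
      have h2 : ∀ x : R, ∃ u, symp (w + x • v) u = 1 := fun x =>
        ⟨-v, by simp [symp_neg_right, symp_add_left, symp_smul_left, symp_self,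
          symp_swap v w, hw]⟩
      have h3 : ∃ u, symp v u = 1 := ⟨w, hw⟩
      rw [sympSum_eq hw]
      simp [h2, h3, -Prod.exists]
    · rw [sympSum_eq_zero hv]
      simp [hv, -Prod.exists]

variable [IsLocalRing R]

/-- By `sum_eq_of_unit_invariant`, μ + N_1 times F(v) is independent of the unimodular v. If μ ≠
-N_1, F is constant on unimodular pairs and μ is the length of an affine line. -/
theorem eigenvalue_of_unit_invariant (hp : IsLocalRing.maximalIdeal R = Ideal.span {p})
    (hE : IsEvenUnimodular F) (h0 : F ≠ 0) (hl : IsLevel p 1 F)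
    (hF : ∀ v, ∀ t : Rˣ, F ((t : R) • v) = F v) (hμ : sympSum F = μ • F) :
    μ = Fintype.card R ∨ μ = -multipleCount p := by
  rw [or_iff_not_imp_right]
  intro hne
  have hne' : μ + multipleCount p ≠ 0 := fun h => hne (eq_neg_of_add_eq_zero_left h)
  have hφ : (Nat.card Rˣ : ℂ) ≠ 0 := Nat.cast_ne_zero.2 Nat.card_pos.ne'
  have key : ∀ v, (∃ w, symp v w = 1) →
      F v = (∑ u, F u) / (Nat.card Rˣ * (μ + multipleCount p)) := by
    rintro v ⟨w, hw⟩
    rw [sum_eq_of_unit_invariant hp hE hl hF hw, hμ, Pi.smul_apply, smul_eq_mul]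
    field_simp
  obtain ⟨v, hv⟩ := Function.ne_iff.1 h0
  obtain ⟨w, hw⟩ := hE.supp v hv
  have h1 := congrFun hμ v
  rw [sympSum_eq hw, Pi.smul_apply, smul_eq_mul] at h1
  have h2 : ∀ x : R, F (w + x • v) = F v := by
    intro x
    rw [key v ⟨w, hw⟩, key]
    exact ⟨-v, by simp [symp_neg_right, symp_add_left, symp_smul_left, symp_self,
      symp_swap v w, hw]⟩
  simp only [h2, Finset.sum_const, nsmul_eq_mul, Finset.card_univ] at h1
  exact (mul_right_cancel₀ hv h1).symm

theorem eigenvalue_cases (hp : IsLocalRing.maximalIdeal R = Ideal.span {p}) (k : ℕ)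
    (hE : IsEvenUnimodular F) (h0 : F ≠ 0) (hl : IsLevel p (k + 1) F)
    (hμ : sympSum F = μ • F) :
    μ = Fintype.card R ∨ μ = -multipleCount p ∨ (μ = 0 ∧ 1 ≤ k) ∨
      ∃ i ≤ k, μ ^ 2 = multipleCount (p ^ (i + 1)) * Fintype.card R ∧
        (i = 0 → ∃ t : Rˣ, ¬ p ∣ (t : R) - 1 ∧ ¬ p ∣ (t : R) + 1) := by
  have hsq : ∀ {c : ℂ} {G : R × R → ℂ}, G ≠ 0 → sympSum G = μ • G →
      sympSum (sympSum G) = c • G → μ ^ 2 = c := by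
    intro c G hG h1 h2
    rw [sympSum_sympSum_eq_sq_smul h1] at h2
    exact smul_left_injective ℂ hG h2
  have hQ : ∀ {j : ℕ} {G : R × R → ℂ}, sympSum G = μ • G →
      sympSum (unitSum p j G) = μ • unitSum p j G := by
    intro j G hG
    rw [sympSum_unitSum, hG]
    ext v
    simp only [unitSum, Pi.smul_apply, smul_eq_mul, Finset.mul_sum, mul_ite, mul_zero]
  induction k generalizing F with
  | zero =>
    by_cases hG : unitSum p 0 F = 0
    · refine Or.inr (Or.inr (Or.inr ⟨0, le_rfl,
        hsq h0 hμ (sympSum_sympSum_of_unitSum_eq_zero hp hE hl hG), fun _ => ?_⟩))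
      -- If every unit is ±1 modulo p, evenness and level 1 make F invariant under all units, so a
      -- vanishing unit sum would force F = 0.
      by_contra! hcon
      refine h0 (eq_zero_of_unitSum_eq_zero hG fun v t _ => ?_)
      by_cases ht : p ∣ (t : R) - 1
      · apply hl
        · simpa [sub_mul] using ht.mul_right v.1
        · simpa [sub_mul] using ht.mul_right v.2
      · rw [← hE.even v]
        apply hl
        · simpa [add_mul] using (hcon t ht).mul_right v.1
        · simpa [add_mul] using (hcon t ht).mul_right v.2
    · rcases eigenvalue_of_unit_invariant hp hE.unitSum hG hl.unitSum
        (fun v t => unitSum_smul (by simp) v) (hQ hμ) with h | h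
      · exact Or.inl h
      · exact Or.inr (Or.inl h)
  | succ k ih =>
    by_cases hG : unitSum p (k + 1) F = 0
    · exact Or.inr (Or.inr (Or.inr ⟨k + 1, le_rfl,
        hsq h0 hμ (sympSum_sympSum_of_unitSum_eq_zero hp hE hl hG), by simp⟩))
    · by_cases hμ0 : μ = 0
      · exact Or.inr (Or.inr (Or.inl ⟨hμ0, by omega⟩))
      have h1 := sympSum_translateSum hp hl.unitSum
        (fun v t ht => unitSum_smul (F := F) ht v)
      have hn : ((Fintype.card R : ℂ) ^ 2) ≠ 0 :=
        pow_ne_zero _ (Nat.cast_ne_zero.2 Fintype.card_ne_zero)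
      rw [hQ hμ, smul_smul] at h1
      -- As μ ≠ 0, the unit sum is a scalar multiple of the operator applied to a function of level
      -- k+1, so its level drops by one.
      have h2 : IsLevel p (k + 1) (unitSum p (k + 1) F) := by
        have h3 := ((IsLevel.translateSum p (k + 1) (unitSum p (k + 1) F)).sympSum hp).const_smul
          ((Fintype.card R : ℂ) ^ 2 * μ)⁻¹
        rwa [h1, inv_smul_smul₀ (mul_ne_zero hn hμ0)] at h3
      rcases ih hE.unitSum hG h2 (hQ hμ) with h | h | h | ⟨i, hi, h⟩
      · exact Or.inl h
      · exact Or.inr (Or.inl h)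
      · exact absurd h.1 hμ0
      · exact Or.inr (Or.inr (Or.inr ⟨i, by omega, h⟩))

/-- Take the indicator of ±(1, 0) modulo p^(k+1) minus its dilate by c. Both have the same unit sum,
and they differ at (1, 0) because c is not ±1 modulo p^(k+1). -/
theorem exists_unitSum_eq_zero (hp : IsLocalRing.maximalIdeal R = Ideal.span {p}) {k : ℕ}
    {c : Rˣ} (hc : p ^ k ∣ (c : R) - 1) (hc1 : ¬ p ^ (k + 1) ∣ (c : R) - 1)
    (hc2 : ¬ p ^ (k + 1) ∣ (c : R) + 1) :
    ∃ F : R × R → ℂ, IsEvenUnimodular F ∧ F ≠ 0 ∧ IsLevel p (k + 1) F ∧ unitSum p k F = 0 := by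
  classical
  let P : R × R → Prop := fun v =>
    p ^ (k + 1) ∣ v.2 ∧ (p ^ (k + 1) ∣ v.1 - 1 ∨ p ^ (k + 1) ∣ v.1 + 1)
  let F : R × R → ℂ := fun v => if P v then 1 else 0
  have hpk : p ∣ p ^ (k + 1) := dvd_pow_self p k.succ_ne_zero
  have hP : ∀ v, P v → IsUnit v.1 := by
    rintro v ⟨-, h | h⟩
    · simpa using isUnit_one_add_of_dvd hp (hpk.trans h)
    · have := isUnit_one_add_of_dvd hp ((hpk.trans h).neg_right)
      rw [show 1 + -(v.1 + 1) = -v.1 by ring] at this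
      exact (IsUnit.neg_iff _).1 this
  have hPneg : ∀ v, P (-v) ↔ P v := by
    intro v
    simp only [P, Prod.fst_neg, Prod.snd_neg, dvd_neg]
    rw [show -v.1 - 1 = -(v.1 + 1) by ring, show -v.1 + 1 = -(v.1 - 1) by ring, dvd_neg, dvd_neg,
      or_comm]
  have hPl : ∀ v w : R × R, p ^ (k + 1) ∣ w.1 - v.1 → p ^ (k + 1) ∣ w.2 - v.2 →
      (P w ↔ P v) := by
    intro v w h1 h2
    simp only [P]
    rw [← dvd_iff_dvd_of_dvd_sub h2, ← dvd_iff_dvd_of_dvd_sub (a := p ^ (k + 1))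
      (b := w.1 - 1) (c := v.1 - 1) (by simpa using h1),
      ← dvd_iff_dvd_of_dvd_sub (a := p ^ (k + 1))
      (b := w.1 + 1) (c := v.1 + 1) (by simpa using h1)]
  let F' : R × R → ℂ := fun v => F ((c : R) • v)
  have hFE : IsEvenUnimodular F :=
    isEvenUnimodular_indicator P hPneg fun v h => exists_symp_eq_one_of_isUnit_fst (hP v h)
  have hFl : IsLevel p (k + 1) F := fun v w h1 h2 => by simp only [F, hPl v w h1 h2]
  have hFE' : IsEvenUnimodular F' :=
    { even := fun v => by simp only [F', smul_neg, hFE.even]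
      supp := fun v hv => by
        obtain ⟨w, hw⟩ := hFE.supp _ hv
        exact ⟨(c : R) • w, by rw [symp_smul_right, ← hw, symp_smul_left]⟩ }
  have hFl' : IsLevel p (k + 1) F' := by
    intro v w h1 h2
    apply hFl
    · simpa only [Prod.smul_fst, smul_eq_mul, mul_sub] using h1.mul_left (c : R)
    · simpa only [Prod.smul_snd, smul_eq_mul, mul_sub] using h2.mul_left (c : R)
  refine ⟨F - F', hFE.sub hFE', ?_, hFl.sub hFl', ?_⟩
  · refine Function.ne_iff.2 ⟨(1, 0), ?_⟩
    have h1 : F (1, 0) = 1 := if_pos (by simp [P])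
    have h2 : F' (1, 0) = 0 := if_neg (by simp [P, hc1, hc2])
    rw [Pi.sub_apply, h1, h2]
    simp
  · have h : unitSum p k (F - F') = unitSum p k F - unitSum p k F' := by
      ext v
      simp only [unitSum, Pi.sub_apply, ← Finset.sum_filter, ← Finset.sum_sub_distrib]
    rw [h, unitSum_comp_smul hc, sub_self]

theorem exists_eigenfunction_of_sq (hp : IsLocalRing.maximalIdeal R = Ideal.span {p}) {k : ℕ}
    (hE : IsEvenUnimodular F) (h0 : F ≠ 0) (hl : IsLevel p (k + 1) F)
    (hu : unitSum p k F = 0)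
    (hμ : μ ^ 2 = multipleCount (p ^ (k + 1)) * Fintype.card R) :
    ∃ G : R × R → ℂ, IsEvenUnimodular G ∧ G ≠ 0 ∧ sympSum G = μ • G := by
  by_contra! hcon
  have key : ∀ G, IsEvenUnimodular G → IsLevel p (k + 1) G → unitSum p k G = 0 →
      sympSum G = -μ • G := by
    intro G hG hGl hGu
    by_contra hne
    -- Since T² = μ² here, T + μ maps into the μ-eigenspace.
    refine hcon (sympSum G + μ • G) (hG.sympSum.add (hG.const_smul μ)) (fun h => hne ?_) ?_
    · rw [neg_smul]
      exact eq_neg_of_add_eq_zero_left h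
    · rw [sympSum_add, sympSum_smul, sympSum_sympSum_of_unitSum_eq_zero hp hG hGl hGu, ← hμ,
        smul_add, smul_smul, sq, add_comm]
  have hμ0 : μ ≠ 0 := by
    rintro rfl
    have h1 := key F hE hl hu
    simp only [neg_zero] at h1
    exact hcon F hE h0 h1
  refine h0 (eq_zero_of_unitSum_eq_zero hu fun v c _ => ?_)
  -- The similitude diag(c⁻¹, 1). Comparing T = -μ on F and on F ∘ g yields F(cv) = F(v) for every
  -- unit c.
  let g : R × R ≃ R × R := Equiv.prodCongr (c⁻¹).mulLeft (Equiv.refl R)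
  have hg1 : ∀ v, (g v).1 = ((c⁻¹ : Rˣ) : R) * v.1 := fun _ => rfl
  have hg2 : ∀ v, (g v).2 = v.2 := fun _ => rfl
  have hgs : ∀ v w, symp (g v) (g w) = ((c⁻¹ : Rˣ) : R) * symp v w := by
    intro v w
    simp only [symp, hg1, hg2]
    ring
  have hgm : ∀ (t : R) v, g (t • v) = t • g v := by
    intro t v
    ext
    · simp only [hg1, Prod.smul_fst, smul_eq_mul]
      ring
    · simp only [hg2, Prod.smul_snd]
  have hgE : IsEvenUnimodular (fun v => F (g v)) :=
    { even := fun v => by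
        have := hgm (-1) v
        simp only [neg_smul, one_smul] at this
        rw [this, hE.even]
      supp := fun v hv => by
        obtain ⟨w, hw⟩ := hE.supp _ hv
        refine ⟨(w.1, ((c⁻¹ : Rˣ) : R) * w.2), ?_⟩
        rw [← hw]
        simp only [symp, hg1, hg2]
        ring }
  have hgl : IsLevel p (k + 1) (fun v => F (g v)) := by
    intro v w h1 h2
    apply hl
    · rw [hg1, hg1, ← mul_sub]
      exact h1.mul_left _
    · rwa [hg2, hg2]
  have hgu : unitSum p k (fun v => F (g v)) = 0 := by
    ext v
    have := congrFun hu (g v)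
    simp only [unitSum, Pi.zero_apply] at this ⊢
    simpa only [hgm] using this
  have h1 := congrFun (key _ hgE hgl hgu) (g.symm v)
  rw [sympSum_comp_of_symp (c := c⁻¹) g hgs, ← sympSum_smul_units, key F hE hl hu] at h1
  simp only [Pi.smul_apply, Equiv.apply_symm_apply, smul_eq_mul] at h1
  exact mul_left_cancel₀ (neg_ne_zero.2 hμ0) h1

/-- The difference of the indicators of two points of the projective line modulo p has total sum
zero, so `sum_eq_of_unit_invariant` gives the eigenvalue. -/
theorem exists_eigenfunction_neg (hp : IsLocalRing.maximalIdeal R = Ideal.span {p}) :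
    ∃ G : R × R → ℂ, IsEvenUnimodular G ∧ G ≠ 0 ∧
      sympSum G = (-(multipleCount p : ℂ)) • G := by
  classical
  have hp1 : ¬ p ∣ 1 := by
    rw [← not_isUnit_iff_dvd hp, not_not]
    exact isUnit_one
  let A : R × R → ℂ := fun v => if IsUnit v.1 ∧ p ∣ v.2 then 1 else 0
  let B : R × R → ℂ := fun v => if IsUnit v.2 ∧ p ∣ v.1 then 1 else 0
  have hA : IsEvenUnimodular A :=
    isEvenUnimodular_indicator (fun v => IsUnit v.1 ∧ p ∣ v.2) (fun v => by simp)
      fun v h => exists_symp_eq_one_of_isUnit_fst h.1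
  have hB : IsEvenUnimodular B :=
    isEvenUnimodular_indicator (fun v => IsUnit v.2 ∧ p ∣ v.1) (fun v => by simp)
      fun v h => exists_symp_eq_one_of_isUnit_snd h.1
  have hu : ∀ a b : R, p ^ 1 ∣ b - a → (IsUnit b ↔ IsUnit a) := by
    intro a b h
    rw [← not_iff_not, not_isUnit_iff_dvd hp, not_isUnit_iff_dvd hp]
    rw [pow_one] at h
    exact dvd_iff_dvd_of_dvd_sub h
  have hd : ∀ a b : R, p ^ 1 ∣ b - a → (p ∣ b ↔ p ∣ a) := by
    intro a b h
    rw [pow_one] at h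
    exact dvd_iff_dvd_of_dvd_sub h
  have hl : IsLevel p 1 (A - B) := by
    intro v w h1 h2
    simp only [A, B, Pi.sub_apply, hu _ _ h1, hu _ _ h2, hd _ _ h1, hd _ _ h2]
  have hinv : ∀ v, ∀ t : Rˣ, (A - B) ((t : R) • v) = (A - B) v := by
    intro v t
    simp [A, B, t.isUnit.dvd_mul_left]
  have hsum : ∑ u, (A - B) u = 0 := by
    simp only [Pi.sub_apply, Finset.sum_sub_distrib]
    rw [sub_eq_zero, ← Equiv.sum_comp (Equiv.prodComm R R)]
    rfl
  refine ⟨A - B, hA.sub hB, Function.ne_iff.2 ⟨(1, 0), by simp [A, B]⟩, ?_⟩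
  ext v
  by_cases hv : ∃ w, symp v w = 1
  · obtain ⟨w, hw⟩ := hv
    have h := sum_eq_of_unit_invariant hp (hA.sub hB) hl hinv hw
    rw [hsum, eq_comm, mul_eq_zero] at h
    have h' := h.resolve_left (Nat.cast_ne_zero.2 Nat.card_pos.ne')
    rw [Pi.smul_apply, smul_eq_mul, neg_mul]
    exact eq_neg_of_add_eq_zero_left h'
  · rw [sympSum_eq_zero hv, Pi.smul_apply, not_imp_comm.1 ((hA.sub hB).supp v) hv, smul_zero]

/-- The points (1 : 0) and (1 : p) of the projective line modulo p² agree modulo p, so averaging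
over translates by p kills the difference of their indicators. `sympSum_translateSum` then shows
that the operator kills it too. -/
theorem exists_eigenfunction_zero (hp : IsLocalRing.maximalIdeal R = Ideal.span {p})
    (hp2 : ¬ p ^ 2 ∣ p) :
    ∃ G : R × R → ℂ, IsEvenUnimodular G ∧ G ≠ 0 ∧ sympSum G = (0 : ℂ) • G := by
  classical
  let A : R × R → ℂ := fun v => if IsUnit v.1 ∧ p ^ 2 ∣ v.2 then 1 else 0
  let B : R × R → ℂ := fun v => if IsUnit v.1 ∧ p ^ 2 ∣ v.2 - p * v.1 then 1 else 0
  have hA : IsEvenUnimodular A :=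
    isEvenUnimodular_indicator (fun v => IsUnit v.1 ∧ p ^ 2 ∣ v.2) (fun v => by simp) fun v h =>
      exists_symp_eq_one_of_isUnit_fst h.1
  have hB : IsEvenUnimodular B := by
    refine isEvenUnimodular_indicator (fun v => IsUnit v.1 ∧ p ^ 2 ∣ v.2 - p * v.1)
      (fun v => ?_) fun v h =>
      exists_symp_eq_one_of_isUnit_fst h.1
    rw [Prod.fst_neg, Prod.snd_neg, IsUnit.neg_iff,
      show -v.2 - p * -v.1 = -(v.2 - p * v.1) by ring, dvd_neg]
  have hu : ∀ a b : R, p ∣ b - a → (IsUnit b ↔ IsUnit a) := by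
    intro a b h
    rw [← not_iff_not, not_isUnit_iff_dvd hp, not_isUnit_iff_dvd hp]
    exact dvd_iff_dvd_of_dvd_sub h
  have hl : IsLevel p 2 (A - B) := by
    intro v w h1 h2
    have h3 : p ^ 2 ∣ (w.2 - p * w.1) - (v.2 - p * v.1) := by
      rw [show (w.2 - p * w.1) - (v.2 - p * v.1) = (w.2 - v.2) - p * (w.1 - v.1) by ring]
      exact dvd_sub h2 (h1.mul_left p)
    simp only [A, B, Pi.sub_apply, hu _ _ ((dvd_pow_self p two_ne_zero).trans h1),
      dvd_iff_dvd_of_dvd_sub h2, dvd_iff_dvd_of_dvd_sub h3]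
  have hinv : ∀ v, ∀ t : Rˣ, (A - B) ((t : R) • v) = (A - B) v := by
    intro v t
    have : (t : R) * v.2 - p * ((t : R) * v.1) = t * (v.2 - p * v.1) := by ring
    simp [A, B, this, t.isUnit.dvd_mul_left]
  have htr : translateSum p 1 (A - B) = 0 := by
    ext v
    simp only [translateSum, Pi.sub_apply, Finset.sum_sub_distrib, Pi.zero_apply]
    -- A shear of the translation parameters that carries one indicator to the other.
    let e : R × R ≃ R × R :=
      Equiv.prodShear (Equiv.refl R) (fun a => Equiv.subRight (v.1 + p * a))
    have he : ∀ a, e a = (a.1, a.2 - (v.1 + p * a.1)) := fun _ => rfl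
    rw [sub_eq_zero, ← Equiv.sum_comp e]
    refine Finset.sum_congr rfl fun a _ => ?_
    have h : v.2 + p * (a.2 - (v.1 + p * a.1)) = v.2 + p * a.2 - p * (v.1 + p * a.1) := by ring
    simp [A, B, he, h]
  refine ⟨A - B, hA.sub hB, Function.ne_iff.2 ⟨(1, 0), by simp [A, B, hp2]⟩, ?_⟩
  have h := sympSum_translateSum (k := 0) hp hl fun v t _ => hinv v t
  have hz : sympSum (0 : R × R → ℂ) = 0 := by
    have := sympSum_smul 0 (0 : R × R → ℂ)
    simpa using this
  rw [zero_add, htr, hz] at h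
  rw [zero_smul]
  exact (smul_eq_zero.1 h.symm).resolve_left
    (pow_ne_zero _ (Nat.cast_ne_zero.2 Fintype.card_ne_zero))

end Spectrum

/-! ### Cardinalities, and units modulo p -/

section Counting

variable {R : Type*} [CommRing R] {p : R}

theorem card_span_singleton_eq_multipleCount [Fintype R] (a : R) :
    Nat.card (Ideal.span {a} : Ideal R) = multipleCount a := by
  classical
  rw [multipleCount, ← Fintype.card_subtype, ← Nat.card_eq_fintype_card]
  exact Nat.card_congr (Equiv.subtypeEquivRight fun x => Ideal.mem_span_singleton)

variable [IsLocalRing R]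

theorem not_pow_succ_dvd_pow (hp : IsLocalRing.maximalIdeal R = Ideal.span {p}) {j : ℕ}
    (h : p ^ j ≠ 0) : ¬ p ^ (j + 1) ∣ p ^ j := by
  rintro ⟨r, hr⟩
  have hu : IsUnit (1 + p * -r) := isUnit_one_add_of_dvd hp (dvd_mul_right p _)
  apply h
  rw [← hu.mul_left_eq_zero]
  linear_combination hr

/-- Multiplication by p^j identifies the residue field with (p^j)/(p^(j+1)) as long as p^j ≠ 0, so
each step contributes a factor q. -/
theorem card_quotient_span_pow [Finite R] (hp : IsLocalRing.maximalIdeal R = Ideal.span {p})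
    {l : ℕ} (h : ∀ j < l, p ^ j ≠ 0) {j : ℕ} (hj : j ≤ l) :
    Nat.card (R ⧸ Ideal.span {p ^ j}) = Nat.card (IsLocalRing.ResidueField R) ^ j := by
  induction j with
  | zero =>
    rw [pow_zero, pow_zero, Ideal.span_singleton_one]
    exact Nat.card_unique
  | succ j ih =>
    have hle : Ideal.span {p ^ (j + 1)} ≤ Ideal.span {p ^ j} :=
      Ideal.span_singleton_le_span_singleton.2 (pow_dvd_pow p j.le_succ)
    rw [← Submodule.card_quotient_mul_card_quotient _ _ hle, ih (by omega),
      pow_succ' (Nat.card (IsLocalRing.ResidueField R))]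
    congr 1
    let f : R →ₗ[R] R ⧸ Ideal.span {p ^ (j + 1)} :=
      (Submodule.mkQ (Ideal.span {p ^ (j + 1)})).comp (LinearMap.mulLeft R (p ^ j))
    have hr : Submodule.map (Submodule.mkQ (Ideal.span {p ^ (j + 1)})) (Ideal.span {p ^ j}) =
        LinearMap.range f := by
      rw [LinearMap.range_comp]
      congr 1
      ext x
      rw [Ideal.mem_span_singleton, LinearMap.mem_range]
      exact ⟨fun ⟨y, hy⟩ => ⟨y, hy.symm⟩, fun ⟨y, hy⟩ => ⟨y, hy.symm⟩⟩
    have hk : LinearMap.ker f = IsLocalRing.maximalIdeal R := by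
      ext x
      have h1 : x ∈ LinearMap.ker f ↔ p ^ (j + 1) ∣ p ^ j * x := by
        rw [LinearMap.mem_ker, LinearMap.comp_apply, Submodule.mkQ_apply,
          Submodule.Quotient.mk_eq_zero, Ideal.mem_span_singleton, LinearMap.mulLeft_apply]
      rw [h1, IsLocalRing.mem_maximalIdeal, mem_nonunits_iff]
      constructor
      · intro h2 hx
        rw [hx.dvd_mul_right] at h2
        exact not_pow_succ_dvd_pow hp (h j hj) h2
      · intro hx
        rw [not_isUnit_iff_dvd hp] at hx
        rw [pow_succ]
        exact mul_dvd_mul_left _ hx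
    rw [hr, ← Nat.card_congr f.quotKerEquivRange.toEquiv, hk]
    rfl

theorem multipleCount_pow [Fintype R] (hp : IsLocalRing.maximalIdeal R = Ideal.span {p})
    {l : ℕ} (h0 : p ^ l = 0) (h : ∀ j < l, p ^ j ≠ 0) {j : ℕ} (hj : j ≤ l) :
    multipleCount (p ^ j) = Nat.card (IsLocalRing.ResidueField R) ^ (l - j) ∧
      Fintype.card R = Nat.card (IsLocalRing.ResidueField R) ^ l := by
  have key : ∀ i ≤ l, Fintype.card R =
      multipleCount (p ^ i) * Nat.card (IsLocalRing.ResidueField R) ^ i := by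
    intro i hi
    rw [← card_quotient_span_pow hp h hi, ← card_span_singleton_eq_multipleCount,
      ← Nat.card_eq_fintype_card]
    exact Submodule.card_eq_card_quotient_mul_card _
  have hn : Fintype.card R = Nat.card (IsLocalRing.ResidueField R) ^ l := by
    rw [key l le_rfl, h0, ← card_span_singleton_eq_multipleCount]
    simp
  refine ⟨?_, hn⟩
  have hq : 0 < Nat.card (IsLocalRing.ResidueField R) ^ j := by
    have : Finite (IsLocalRing.ResidueField R) :=
      Finite.of_surjective _ IsLocalRing.residue_surjective
    exact pow_pos Nat.card_pos j
  apply Nat.eq_of_mul_eq_mul_right hq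
  rw [← key j hj, hn, ← pow_add, Nat.sub_add_cancel hj]

theorem two_ne_zero_of_odd_card {K : Type*} [Field K] [Finite K] (h : Odd (Nat.card K)) :
    (2 : K) ≠ 0 := by
  intro h2
  have h1 : addOrderOf (1 : K) = 2 :=
    addOrderOf_eq_prime (by simpa using h2) one_ne_zero
  have h3 := addOrderOf_dvd_natCard (1 : K)
  rw [h1] at h3
  exact Nat.not_even_iff_odd.2 h (even_iff_two_dvd.2 h3)

theorem card_eq_three_iff {K : Type*} [Field K] [Finite K] (h : Odd (Nat.card K)) :
    Nat.card K = 3 ↔ ∀ x : K, x = 0 ∨ x = 1 ∨ x = -1 := by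
  classical
  have : Fintype K := Fintype.ofFinite K
  have h2 : (1 : K) ≠ -1 := by
    intro h1
    apply two_ne_zero_of_odd_card h
    linear_combination h1
  have h3 : ({0, 1, -1} : Finset K).card = 3 :=
    Finset.card_eq_three.2 ⟨0, 1, -1, zero_ne_one, by simp, h2, rfl⟩
  rw [Nat.card_eq_fintype_card, eq_comm, ← h3, Finset.card_eq_iff_eq_univ,
    Finset.eq_univ_iff_forall]
  simp

theorem residue_eq_zero_iff_dvd (hp : IsLocalRing.maximalIdeal R = Ideal.span {p}) (x : R) :
    IsLocalRing.residue R x = 0 ↔ p ∣ x := by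
  rw [IsLocalRing.residue_eq_zero_iff, hp, Ideal.mem_span_singleton]

/-- Such a unit is missing exactly when the residue field is {0, 1, -1}; this is what makes q = 3
exceptional. -/
theorem exists_unit_not_dvd_iff [Finite R]
    (hp : IsLocalRing.maximalIdeal R = Ideal.span {p})
    (hq : Odd (Nat.card (IsLocalRing.ResidueField R))) :
    (∃ t : Rˣ, ¬ p ∣ (t : R) - 1 ∧ ¬ p ∣ (t : R) + 1) ↔
      Nat.card (IsLocalRing.ResidueField R) ≠ 3 := by
  have : Finite (IsLocalRing.ResidueField R) :=
    Finite.of_surjective _ IsLocalRing.residue_surjective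
  have key : ∀ x : R, (p ∣ x ∨ p ∣ x - 1 ∨ p ∣ x + 1) ↔ (IsLocalRing.residue R x = 0 ∨
      IsLocalRing.residue R x = 1 ∨ IsLocalRing.residue R x = -1) := by
    intro x
    rw [← residue_eq_zero_iff_dvd hp, ← residue_eq_zero_iff_dvd hp,
      ← residue_eq_zero_iff_dvd hp, map_sub, map_add, map_one, sub_eq_zero,
      add_eq_zero_iff_eq_neg]
  rw [Ne, card_eq_three_iff hq, IsLocalRing.residue_surjective.forall]
  simp only [← key]
  push Not
  constructor
  · rintro ⟨t, h1, h2⟩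
    exact ⟨t, (not_isUnit_iff_dvd hp _).not.1 (not_not.2 t.isUnit), h1, h2⟩
  · rintro ⟨x, h0, h1, h2⟩
    rw [← not_isUnit_iff_dvd hp, not_not] at h0
    obtain ⟨t, rfl⟩ := h0
    exact ⟨t, h1, h2⟩

theorem not_dvd_two [Finite R] (hp : IsLocalRing.maximalIdeal R = Ideal.span {p})
    (hq : Odd (Nat.card (IsLocalRing.ResidueField R))) : ¬ p ∣ 2 := by
  have : Finite (IsLocalRing.ResidueField R) :=
    Finite.of_surjective _ IsLocalRing.residue_surjective
  rw [← residue_eq_zero_iff_dvd hp, map_ofNat]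
  exact two_ne_zero_of_odd_card hq

end Counting

/-! ### The spectrum in terms of q and the nilpotency index -/

theorem mem_adjEigenvalues_platonicGraph_iff_sq {R : Type*} [CommRing R] [Finite R]
    [IsLocalRing R] {p : R} (hp : IsLocalRing.maximalIdeal R = Ideal.span {p}) {q l : ℕ}
    (hq : q = Nat.card (IsLocalRing.ResidueField R)) (hodd : Odd q) (hl1 : 1 ≤ l)
    (h0 : p ^ l = 0) (h : ∀ j < l, p ^ j ≠ 0) (μ : ℂ) :
    μ ∈ adjEigenvalues (platonicGraph R) ↔
      μ = (q : ℂ) ^ l ∨ μ = -(q : ℂ) ^ (l - 1) ∨ (μ = 0 ∧ 2 ≤ l) ∨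
        ∃ k, 1 ≤ k ∧ k ≤ l ∧ μ ^ 2 = (q : ℂ) ^ (2 * l - k) ∧ (k = 1 → q ≠ 3) := by
  have : Fintype R := Fintype.ofFinite R
  subst hq
  have h2 : (1 : R) ≠ -1 := by
    intro h1
    apply not_dvd_two hp hodd
    rw [show (2 : R) = 0 by linear_combination h1]
    exact dvd_zero p
  obtain ⟨hN1, hn⟩ := multipleCount_pow hp h0 h hl1
  rw [pow_one] at hN1
  have hsq : ∀ k, 1 ≤ k → k ≤ l →
      (multipleCount (p ^ k) : ℂ) * Fintype.card R =
        (Nat.card (IsLocalRing.ResidueField R) : ℂ) ^ (2 * l - k) := by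
    intro k _ hk
    rw [(multipleCount_pow hp h0 h hk).1, hn]
    push_cast
    rw [← pow_add]
    congr 1
    omega
  rw [mem_adjEigenvalues_platonicGraph_iff h2]
  constructor
  · rintro ⟨F, hE, hF, hμ⟩
    obtain ⟨m, rfl⟩ : ∃ m, l = m + 1 := ⟨l - 1, by omega⟩
    -- As p^l = 0, every function has level l, which starts the descent.
    have hl : IsLevel p (m + 1) F := by
      intro v w h3 h4
      rw [h0, zero_dvd_iff, sub_eq_zero] at h3 h4
      rw [Prod.ext h3 h4]
    rcases eigenvalue_cases hp m hE hF hl hμ with h3 | h3 | h3 | ⟨i, hi, h3, h4⟩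
    · exact Or.inl (by rw [h3, hn]; push_cast; rfl)
    · exact Or.inr (Or.inl (by rw [h3, hN1]; push_cast; rfl))
    · exact Or.inr (Or.inr (Or.inl ⟨h3.1, by omega⟩))
    · refine Or.inr (Or.inr (Or.inr ⟨i + 1, by omega, by omega, ?_, fun h5 => ?_⟩))
      · rw [h3, hsq _ (by omega) (by omega)]
      · exact (exists_unit_not_dvd_iff hp hodd).1 (h4 (by omega))
  · rintro (rfl | rfl | ⟨rfl, h3⟩ | ⟨k, hk1, hkl, hμ, h3⟩)
    · have := exists_eigenfunction_card (R := R)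
      rw [hn] at this
      exact_mod_cast this
    · have := exists_eigenfunction_neg hp
      rw [hN1] at this
      exact_mod_cast this
    · have h4 := not_pow_succ_dvd_pow hp (h 1 (by omega))
      rw [pow_one] at h4
      exact exists_eigenfunction_zero hp h4
    · obtain ⟨j, rfl⟩ : ∃ j, k = j + 1 := ⟨k - 1, by omega⟩
      rw [← hsq _ hk1 hkl] at hμ
      have hc : ∃ c : Rˣ, p ^ j ∣ (c : R) - 1 ∧ ¬ p ^ (j + 1) ∣ (c : R) - 1 ∧
          ¬ p ^ (j + 1) ∣ (c : R) + 1 := by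
        rcases Nat.eq_zero_or_pos j with rfl | hj
        · obtain ⟨c, hc1, hc2⟩ := (exists_unit_not_dvd_iff hp hodd).2 (h3 rfl)
          exact ⟨c, by simp, by simpa using hc1, by simpa using hc2⟩
        -- For j ≥ 1 take c = 1 + p^j; then c + 1 is 2 modulo p, which is nonzero because q is odd.
        · have hpj : p ∣ p ^ j := dvd_pow_self p (by omega)
          obtain ⟨c, hc⟩ := isUnit_one_add_of_dvd hp hpj
          refine ⟨c, by simp [hc], ?_, ?_⟩
          · rw [hc, add_sub_cancel_left]
            exact not_pow_succ_dvd_pow hp (h j (by omega))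
          · intro hd
            have hd' : p ∣ (c : R) + 1 := (dvd_pow_self p j.succ_ne_zero).trans hd
            rw [hc, show 1 + p ^ j + 1 = 2 + p ^ j by ring, dvd_add_left hpj] at hd'
            exact not_dvd_two hp hodd hd'
      obtain ⟨c, hc, hc1, hc2⟩ := hc
      obtain ⟨F, hE, hF, hl, hu⟩ := exists_unitSum_eq_zero hp hc hc1 hc2
      exact exists_eigenfunction_of_sq hp hE hF hl hu hμ

theorem sq_eq_pow_two_mul_sub_iff (q : ℕ) {l k : ℕ} (hk : k ≤ l) (μ : ℂ) :
    μ ^ 2 = (q : ℂ) ^ (2 * l - k) ↔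
      μ = (((q : ℝ) ^ ((l : ℝ) - (k : ℝ) / 2) : ℝ) : ℂ) ∨
        μ = ((-(q : ℝ) ^ ((l : ℝ) - (k : ℝ) / 2) : ℝ) : ℂ) := by
  have h1 : ((q : ℝ) ^ ((l : ℝ) - (k : ℝ) / 2)) ^ 2 = (q : ℝ) ^ (2 * l - k) := by
    rw [← Real.rpow_natCast, ← Real.rpow_mul (Nat.cast_nonneg q), ← Real.rpow_natCast]
    congr 1
    rw [Nat.cast_sub (by omega)]
    push_cast
    ring
  have h2 : (q : ℂ) ^ (2 * l - k) = (((q : ℝ) ^ ((l : ℝ) - (k : ℝ) / 2) : ℝ) : ℂ) ^ 2 := by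
    rw [← Complex.ofReal_pow, h1]
    push_cast
    rfl
  rw [h2, sq_eq_sq_iff_eq_or_eq_neg, Complex.ofReal_neg]

theorem neg_pow_eq_neg_rpow (q : ℕ) {l : ℕ} (hl : 1 ≤ l) :
    -(q : ℂ) ^ (l - 1) = ((-(q : ℝ) ^ ((l : ℝ) - ((2 : ℕ) : ℝ) / 2) : ℝ) : ℂ) := by
  have : (l : ℝ) - ((2 : ℕ) : ℝ) / 2 = ((l - 1 : ℕ) : ℝ) := by
    rw [Nat.cast_sub hl]
    norm_num
  rw [this, Real.rpow_natCast]
  push_cast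
  rfl

theorem mainTheorem7 (R : Type*) [CommRing R] [Finite R] [IsLocalRing R] [IsPrincipalIdealRing R]
    (ϖ : R) (hϖ : IsLocalRing.maximalIdeal R = Ideal.span {ϖ})
    (q l : ℕ) (hq : q = Nat.card (IsLocalRing.ResidueField R)) (hq_odd : Odd q)
    (hl : l = nilpotencyClass ϖ) :
    (IsField R ↔ l = 1) ∧ (¬ IsField R ↔ 2 ≤ l) ∧
    (IsField R →
      (q ≠ 3 → adjEigenvalues (platonicGraph R) =
        Complex.ofReal '' {(q : ℝ), -1, (q : ℝ) ^ (1 / 2 : ℝ), -(q : ℝ) ^ (1 / 2 : ℝ)}) ∧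
      (q = 3 → adjEigenvalues (platonicGraph R) = Complex.ofReal '' {(q : ℝ), -1})) ∧
    (2 ≤ l →
      (q ≠ 3 → adjEigenvalues (platonicGraph R) =
        Complex.ofReal '' ({(q : ℝ) ^ l, 0} ∪
          {x : ℝ | ∃ k : ℕ, 1 ≤ k ∧ k ≤ l ∧
            (x = (q : ℝ) ^ ((l : ℝ) - (k : ℝ) / 2) ∨
              x = -(q : ℝ) ^ ((l : ℝ) - (k : ℝ) / 2))})) ∧
      (q = 3 → adjEigenvalues (platonicGraph R) =
        Complex.ofReal '' ({(q : ℝ) ^ l, 0} ∪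
          {x : ℝ | ∃ k : ℕ, 2 ≤ k ∧ k ≤ l ∧
            (x = (q : ℝ) ^ ((l : ℝ) - (k : ℝ) / 2) ∨
              x = -(q : ℝ) ^ ((l : ℝ) - (k : ℝ) / 2))}))) := by
  have hnil : IsNilpotent ϖ := by
    rw [Ring.KrullDimLE.isNilpotent_iff_mem_maximalIdeal, hϖ]
    exact Ideal.mem_span_singleton_self ϖ
  have hl1 : 1 ≤ l := by
    rw [hl]
    exact pos_nilpotencyClass_iff.2 hnil
  have h0 : ϖ ^ l = 0 := by
    rw [hl]
    exact pow_nilpotencyClass hnil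
  have h : ∀ j < l, ϖ ^ j ≠ 0 := by
    intro j hj hj0
    rw [hl] at hj
    exact Nat.notMem_of_lt_sInf hj hj0
  have hfield : IsField R ↔ l = 1 := by
    rw [IsLocalRing.isField_iff_maximalIdeal_eq, hϖ, Ideal.span_singleton_eq_bot, hl,
      nilpotencyClass_eq_one]
  have hmem := mem_adjEigenvalues_platonicGraph_iff_sq hϖ hq hq_odd hl1 h0 h
  have hpow : ∀ x : ℂ, (∃ y : ℝ, (y = (q : ℝ) ^ l ∨ y = 0) ∧ (y : ℂ) = x) ↔
      x = (q : ℂ) ^ l ∨ x = 0 := by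
    intro x
    constructor
    · rintro ⟨y, rfl | rfl, rfl⟩
      · exact Or.inl (by push_cast; rfl)
      · exact Or.inr Complex.ofReal_zero
    · rintro (rfl | rfl)
      · exact ⟨_, Or.inl rfl, by push_cast; rfl⟩
      · exact ⟨_, Or.inr rfl, Complex.ofReal_zero⟩
  have hhalf : (q : ℝ) ^ (1 / 2 : ℝ) = (q : ℝ) ^ (((1 : ℕ) : ℝ) - ((1 : ℕ) : ℝ) / 2) := by
    norm_num
  refine ⟨hfield, ?_, fun hR => ⟨fun hq3 => ?_, fun hq3 => ?_⟩,
    fun hl2 => ⟨fun hq3 => ?_, fun hq3 => ?_⟩⟩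
  · rw [hfield]
    omega
  · obtain rfl := hfield.1 hR
    ext μ
    rw [hmem, hhalf]
    simp only [Set.image_insert_eq, Set.image_singleton, Set.mem_insert_iff,
      Set.mem_singleton_iff]
    rw [← sq_eq_pow_two_mul_sub_iff q le_rfl]
    constructor
    · rintro (h3 | h3 | h3 | ⟨k, hk1, hk2, h3, -⟩)
      · exact Or.inl (by simpa using h3)
      · exact Or.inr (Or.inl (by simpa using h3))
      · omega
      · obtain rfl : k = 1 := by omega
        exact Or.inr (Or.inr h3)
    · rintro (h3 | h3 | h3)
      · exact Or.inl (by simpa using h3)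
      · exact Or.inr (Or.inl (by simpa using h3))
      · exact Or.inr (Or.inr (Or.inr ⟨1, le_rfl, le_rfl, h3, fun _ => hq3⟩))
  · obtain rfl := hfield.1 hR
    ext μ
    rw [hmem]
    simp only [Set.image_insert_eq, Set.image_singleton, Set.mem_insert_iff,
      Set.mem_singleton_iff]
    constructor
    · rintro (h3 | h3 | h3 | ⟨k, hk1, hk2, -, h3⟩)
      · exact Or.inl (by simpa using h3)
      · exact Or.inr (by simpa using h3)
      · omega
      · exact absurd hq3 (h3 (by omega))
    · rintro (h3 | h3)
      · exact Or.inl (by simpa using h3)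
      · exact Or.inr (Or.inl (by simpa using h3))
  · ext μ
    rw [hmem, Set.image_union]
    constructor
    · rintro (h3 | h3 | h3 | ⟨k, hk1, hk2, h3, -⟩)
      · exact Or.inl ((hpow μ).2 (Or.inl h3))
      -- The value -q^(l-1) is the negative root for k = 2, available because l ≥ 2.
      · rw [neg_pow_eq_neg_rpow q hl1] at h3
        exact Or.inr ⟨_, ⟨2, by omega, hl2, Or.inr rfl⟩, h3.symm⟩
      · exact Or.inl ((hpow μ).2 (Or.inr h3.1))
      · rcases (sq_eq_pow_two_mul_sub_iff q hk2 μ).1 h3 with h4 | h4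
        · exact Or.inr ⟨_, ⟨k, hk1, hk2, Or.inl rfl⟩, h4.symm⟩
        · exact Or.inr ⟨_, ⟨k, hk1, hk2, Or.inr rfl⟩, h4.symm⟩
    · rintro (h3 | ⟨x, ⟨k, hk1, hk2, h3⟩, rfl⟩)
      · rcases (hpow μ).1 h3 with h4 | h4
        · exact Or.inl h4
        · exact Or.inr (Or.inr (Or.inl ⟨h4, hl2⟩))
      · refine Or.inr (Or.inr (Or.inr ⟨k, hk1, hk2, ?_, fun _ => hq3⟩))
        rw [sq_eq_pow_two_mul_sub_iff q hk2]
        exact h3.imp (congrArg _) (congrArg _)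
  · ext μ
    rw [hmem, Set.image_union]
    constructor
    · rintro (h3 | h3 | h3 | ⟨k, hk1, hk2, h3, h5⟩)
      · exact Or.inl ((hpow μ).2 (Or.inl h3))
      · rw [neg_pow_eq_neg_rpow q hl1] at h3
        exact Or.inr ⟨_, ⟨2, le_rfl, hl2, Or.inr rfl⟩, h3.symm⟩
      · exact Or.inl ((hpow μ).2 (Or.inr h3.1))
      · have hk : 2 ≤ k := by
          by_contra hk
          exact h5 (by omega) hq3
        rcases (sq_eq_pow_two_mul_sub_iff q hk2 μ).1 h3 with h4 | h4
        · exact Or.inr ⟨_, ⟨k, hk, hk2, Or.inl rfl⟩, h4.symm⟩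
        · exact Or.inr ⟨_, ⟨k, hk, hk2, Or.inr rfl⟩, h4.symm⟩
    · rintro (h3 | ⟨x, ⟨k, hk1, hk2, h3⟩, rfl⟩)
      · rcases (hpow μ).1 h3 with h4 | h4
        · exact Or.inl h4
        · exact Or.inr (Or.inr (Or.inl ⟨h4, hl2⟩))
      · refine Or.inr (Or.inr (Or.inr ⟨k, by omega, hk2, ?_, fun _ => by omega⟩))
        rw [sq_eq_pow_two_mul_sub_iff q hk2]
        exact h3.imp (congrArg _) (congrArg _)
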